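/- Let $\mathcal{P}(x_1,\dots,x_N)$ denote the space of real polynomials in $N$ variables, and for a compact set $E\subset\mathbb{R}^N$ and a polynomial $P$ put $\|P\|_E=\sup_{E}|P|$. For $1\le k\le N$ and $d\ge 0$, let $\mathcal{P}(y)\otimes\mathcal{P}_d(x_k)$ be the subspace of $\mathcal{P}(x_1,\dots,x_N)$ of all polynomials $\sum_{i=0}^{d}G_i(y)\,x_k^i$, where $y$ stands for the variables other than $x_k$ and the $G_i$ are real polynomials in $y$. Let $\mathbf{F}\subset\mathcal{P}(x_1,\dots,x_N)$ be an infinite-dimensional linear subspace such that $D^\alpha P\in\mathbf{F}$ for all $P\in\mathbf{F}$ and all $\alpha\in\mathbb{Z}_{\ge 0}^N$. A compact set $E\subset\mathbb{R}^N$ is called $\mathbf{F}$-Markov if there are real constants $M,m>0$ such that $$\|D^{\alpha}P\|_E\le M^{|\alpha|}(\deg P)^{m|\alpha|}\,\|P\|_E\qquad\text{for all }P\in\mathbf{F},\ \alpha\in\mathbb{Z}_{\ge 0}^N ,$$ where $|\alpha|=\alpha_1+\dots+\alpha_N$, $\deg P$ is the total degree (with $\deg 0:=0$), and $0^0:=1$.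 In $\mathbb{R}^2$ with coordinates $(x,y)$, let $V=\{y^3=1-x^2\}$ and $$E=\left\{(x,y)\in V:\ x\in\left[-\tfrac12,-\tfrac14\right]\cup\left[\tfrac14,\tfrac12\right]\right\}.$$ Then the compact set $E$ is $\mathcal{P}(y)\otimes\mathcal{P}_1(x)$-Markov, but it is not $\mathcal{P}(x)\otimes\mathcal{P}_2(y)$-Markov. -/

import Mathlib

namespace MarkovInequality

/-- `D^α P = ∂₁^{α₁} ⋯ ∂_N^{α_N} P`, the partial derivative of the polynomial `P` of order `α`. -/
noncomputable def iterDeriv {N : ℕ} (α : Fin N → ℕ) (P : MvPolynomial (Fin N) ℝ) :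
    MvPolynomial (Fin N) ℝ :=
  (List.ofFn fun i : Fin N =>
    ((MvPolynomial.pderiv i).toLinearMap : Module.End ℝ (MvPolynomial (Fin N) ℝ)) ^ α i).prod P

/-- The length `|α| = α₁ + ⋯ + α_N` of a multi-index. -/
def multiLength {N : ℕ} (α : Fin N → ℕ) : ℕ := ∑ i, α i

/-- `‖P‖_E = sup_{x ∈ E} |P(x)|`. -/
noncomputable def supNorm {N : ℕ} (E : Set (Fin N → ℝ)) (P : MvPolynomial (Fin N) ℝ) : ℝ :=
  ⨆ x : E, |MvPolynomial.eval (x : Fin N → ℝ) P|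

/-- An infinite-dimensional subspace of `𝒫(x₁, …, x_N)` that is invariant under all `D^α`. -/
structure PolySpace (N : ℕ) where
  toSubmodule : Submodule ℝ (MvPolynomial (Fin N) ℝ)
  infinite_dim : ¬ FiniteDimensional ℝ toSubmodule
  iterDeriv_mem : ∀ P ∈ toSubmodule, ∀ α : Fin N → ℕ, iterDeriv α P ∈ toSubmodule

/-- The compact set `E ⊆ ℝ^N` is an `F`-Markov set: for some constants `M, m > 0`,
`‖D^α P‖_E ≤ M^{|α|} (deg P)^{m |α|} ‖P‖_E` for all `P ∈ F` and all multi-indices `α`. -/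
def IsMarkovSet {N : ℕ} (F : PolySpace N) (E : Set (Fin N → ℝ)) : Prop :=
  IsCompact E ∧ ∃ M m : ℝ, 0 < M ∧ 0 < m ∧
    ∀ P ∈ F.toSubmodule, ∀ α : Fin N → ℕ,
      supNorm E (iterDeriv α P) ≤
        M ^ multiLength α * (P.totalDegree : ℝ) ^ (m * (multiLength α : ℝ)) * supNorm E P

/-- The subspace `𝒫(y) ⊗ 𝒫_d(x_k)` of `𝒫(x₁, …, x_N)`, where `y` stands for all the variables
other than `x_k`: the polynomials `∑_{i = 0}^{d} G_i(y) x_k^i` with `G_i ∈ 𝒫(y)`. -/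
def tensorSubmodule {N : ℕ} (k : Fin N) (d : ℕ) : Submodule ℝ (MvPolynomial (Fin N) ℝ) where
  carrier := {P | ∃ G : ℕ → MvPolynomial (Fin N) ℝ,
    (∀ i, G i ∈ MvPolynomial.supported ℝ ({k}ᶜ : Set (Fin N))) ∧
      P = ∑ i ∈ Finset.range (d + 1), G i * MvPolynomial.X k ^ i}
  zero_mem' := ⟨0, fun _ => Subalgebra.zero_mem _, by simp⟩
  add_mem' := by
    rintro _ _ ⟨G, hG, rfl⟩ ⟨H, hH, rfl⟩
    exact ⟨G + H, fun i => Subalgebra.add_mem _ (hG i) (hH i),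
      by simp [add_mul, Finset.sum_add_distrib]⟩
  smul_mem' := by
    rintro c _ ⟨G, hG, rfl⟩
    exact ⟨c • G, fun i => Subalgebra.smul_mem _ (hG i) c,
      by simp [Finset.smul_sum]⟩

theorem pderiv_mem_supported {N : ℕ} (s : Set (Fin N)) (j : Fin N)
    {G : MvPolynomial (Fin N) ℝ} (hG : G ∈ MvPolynomial.supported ℝ s) :
    MvPolynomial.pderiv j G ∈ MvPolynomial.supported ℝ s := by
  rw [MvPolynomial.supported] at hG ⊢
  induction hG using Algebra.adjoin_induction with
  | mem x hx =>
    obtain ⟨i, -, rfl⟩ := hx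
    rw [MvPolynomial.pderiv_X]
    by_cases h : i = j
    · subst h; simp
    · rw [Pi.single_eq_of_ne h]; exact Subalgebra.zero_mem _
  | algebraMap r => simp
  | add x y _ _ hx hy => rw [map_add]; exact Subalgebra.add_mem _ hx hy
  | mul x y hx' hy' hx hy =>
    rw [Derivation.leibniz]
    exact Subalgebra.add_mem _ (Subalgebra.mul_mem _ hx' hy) (Subalgebra.mul_mem _ hy' hx)

theorem pderiv_eq_zero_of_mem_supported {N : ℕ} (k : Fin N)
    {G : MvPolynomial (Fin N) ℝ} (hG : G ∈ MvPolynomial.supported ℝ ({k}ᶜ : Set (Fin N))) :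
    MvPolynomial.pderiv k G = 0 := by
  apply MvPolynomial.pderiv_eq_zero_of_notMem_vars
  intro h
  exact (MvPolynomial.mem_supported.1 hG) h rfl

theorem pderiv_mem_tensorSubmodule {N : ℕ} (k j : Fin N) (d : ℕ)
    {P : MvPolynomial (Fin N) ℝ} (hP : P ∈ tensorSubmodule k d) :
    MvPolynomial.pderiv j P ∈ tensorSubmodule k d := by
  obtain ⟨G, hG, rfl⟩ := hP
  by_cases h : j = k
  · subst h
    refine ⟨fun i => if i < d then ((i : ℝ) + 1) • G (i + 1) else 0, fun i => ?_, ?_⟩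
    · dsimp only
      split_ifs
      · exact Subalgebra.smul_mem _ (hG _) _
      · exact Subalgebra.zero_mem _
    · rw [map_sum, Finset.sum_range_succ', Finset.sum_range_succ]
      simp only [Derivation.leibniz, pderiv_eq_zero_of_mem_supported j (hG _)]
      simp only [lt_irrefl, if_false, zero_mul, add_zero, pow_zero, smul_zero]
      refine Eq.trans (add_eq_left.2 (by simp)) (Finset.sum_congr rfl fun i hi => ?_)
      rw [if_pos (Finset.mem_range.1 hi), Derivation.leibniz_pow]
      simp [MvPolynomial.smul_eq_C_mul]
      ring
  · refine ⟨fun i => MvPolynomial.pderiv j (G i), fun i => pderiv_mem_supported _ j (hG i), ?_⟩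
    rw [map_sum]
    refine Finset.sum_congr rfl fun i _ => ?_
    rw [Derivation.leibniz, Derivation.leibniz_pow, MvPolynomial.pderiv_X_of_ne (Ne.symm h)]
    simp [mul_comm]

theorem iterDeriv_mem_tensorSubmodule {N : ℕ} (k : Fin N) (d : ℕ)
    (P : MvPolynomial (Fin N) ℝ) (hP : P ∈ tensorSubmodule k d) (α : Fin N → ℕ) :
    iterDeriv α P ∈ tensorSubmodule k d := by
  have key : ∀ l : List (Module.End ℝ (MvPolynomial (Fin N) ℝ)),
      (∀ T ∈ l, ∀ Q ∈ tensorSubmodule k d, T Q ∈ tensorSubmodule k d) →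
      l.prod P ∈ tensorSubmodule k d := by
    intro l
    induction l with
    | nil => intro _; simpa using hP
    | cons T l ih =>
      intro h
      rw [List.prod_cons, Module.End.mul_apply]
      exact h T (by simp) _ (ih fun S hS => h S (by simp [hS]))
  apply key
  intro T hT
  obtain ⟨i, rfl⟩ := (List.mem_ofFn' _ _).1 hT
  dsimp only
  generalize α i = n
  induction n with
  | zero => intro Q hQ; simpa using hQ
  | succ n ih =>
    intro Q hQ
    rw [pow_succ, Module.End.mul_apply]
    exact ih _ (pderiv_mem_tensorSubmodule k i d hQ)

theorem not_finiteDimensional_tensorSubmodule {N : ℕ} [Nontrivial (Fin N)] (k : Fin N) (d : ℕ) :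
    ¬ FiniteDimensional ℝ (tensorSubmodule k d) := by
  intro hfin
  obtain ⟨j, hj⟩ := exists_ne k
  have hmem : ∀ n : ℕ, (MvPolynomial.X j : MvPolynomial (Fin N) ℝ) ^ n ∈ tensorSubmodule k d := by
    intro n
    refine ⟨fun i => if i = 0 then MvPolynomial.X j ^ n else 0, fun i => ?_, ?_⟩
    · dsimp only
      split_ifs
      · exact Subalgebra.pow_mem _ (MvPolynomial.X_mem_supported.2 hj) _
      · exact Subalgebra.zero_mem _
    · simp
  have hli : LinearIndependent ℝ
      (fun n : ℕ => (MvPolynomial.X j : MvPolynomial (Fin N) ℝ) ^ n) := by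
    have h := (MvPolynomial.basisMonomials (Fin N) ℝ).linearIndependent.comp
      (fun n : ℕ => Finsupp.single j n) (Finsupp.single_injective j)
    have e : (MvPolynomial.basisMonomials (Fin N) ℝ) ∘ (fun n : ℕ => Finsupp.single j n) =
        fun n : ℕ => (MvPolynomial.X j : MvPolynomial (Fin N) ℝ) ^ n := by
      funext n
      simp [MvPolynomial.X_pow_eq_monomial]
    rw [e] at h
    exact h
  have hli' : LinearIndependent ℝ
      (fun n : ℕ => (⟨MvPolynomial.X j ^ n, hmem n⟩ : tensorSubmodule k d)) :=
    LinearIndependent.of_comp (tensorSubmodule k d).subtype hli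
  have := hli'.finite
  exact not_finite ℕ

/-- The space `𝒫(y) ⊗ 𝒫_d(x_k)`, with `y` all the variables other than `x_k`, for `N ≥ 2`. -/
def tensorSpace {N : ℕ} [Nontrivial (Fin N)] (k : Fin N) (d : ℕ) : PolySpace N where
  toSubmodule := tensorSubmodule k d
  infinite_dim := not_finiteDimensional_tensorSubmodule k d
  iterDeriv_mem := iterDeriv_mem_tensorSubmodule k d

/-- The algebraic curve `V = {y³ = 1 - x²}` in `ℝ²`, with `x = p 0` and `y = p 1`. -/
def curveV : Set (Fin 2 → ℝ) := {p | p 1 ^ 3 = 1 - p 0 ^ 2}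

/-- `E = {(x, y) ∈ V : x ∈ [-1/2, -1/4] ∪ [1/4, 1/2]}`. -/
def setE : Set (Fin 2 → ℝ) :=
  {p | p ∈ curveV ∧ p 0 ∈ Set.Icc (-1 / 2 : ℝ) (-1 / 4) ∪ Set.Icc (1 / 4 : ℝ) (1 / 2)}

end MarkovInequality

/-! Positive part: `E` is symmetric under `x ↦ -x`, projects onto an interval `[a, b]` of the
`y`-axis, and satisfies `|x| ≥ 1/4`. For `P = G₀(y) + G₁(y) x`, the values at `(±x, y)` therefore
bound `G₀` and `G₁` on all of `[a, b]`. Now `∂ₓP = G₁`, and `∂_yP` is handled by the one-variable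
Markov inequality on `[a, b]` with `x` frozen.

Negative part: reduce `(y - 1)^n` modulo `y³ = 1 - x²` to `g₀ + g₁ y + g₂ y²` with `gᵢ` polynomials
in `x`. On `E` its norm is at most `2⁻ⁿ`, since `1/2 ≤ y ≤ 1`, and its degree is `O(n)`. Markov
bounds for `∂_y` and `∂_y²` would make every `gᵢ yⁱ` tend to `0` on `E`. But the product of the
values at the conjugates `ωy`, `ω²y` is `(y² + y + 1)^n ≥ 1`, and it is a quadratic form in the `gᵢ
yⁱ`. -/

open MvPolynomial in
theorem MvPolynomial.totalDegree_pderiv_le {σ R : Type*} [CommSemiring R] (i : σ)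
    (P : MvPolynomial σ R) : (pderiv i P).totalDegree ≤ P.totalDegree := by
  classical
  conv_lhs => rw [P.as_sum, map_sum]
  refine totalDegree_finsetSum_le fun s hs => ?_
  rw [pderiv_monomial]
  refine (totalDegree_monomial_le _ _).trans (le_trans ?_ (le_totalDegree hs))
  exact Finsupp.sum_le_sum_index (tsub_le_self) (fun _ _ _ _ h => h) (fun _ _ => rfl)

/-! ### One-variable Markov inequality -/

namespace Polynomial

/-- Markov's inequality at an endpoint of a nondegenerate segment. -/
theorem abs_eval_derivative_mul_le {p : ℝ[X]} {n : ℕ} {u v B : ℝ} (hp : p.natDegree ≤ n)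
    (hB : 0 < B) (h : ∀ t ∈ Set.uIcc u v, |p.eval t| ≤ B) :
    |p.derivative.eval v| * |v - u| ≤ 2 * (n : ℝ) ^ 2 * B := by
  -- The two choices `c = ±B⁻¹` normalise the bound to `1` and upgrade a one-sided comparison with
  -- `Tₙ'(1) = n²` to absolute values. The affine substitution sends `-1` to `u` and `1` to `v`.
  have key : ∀ c : ℝ, |c| = B⁻¹ →
      c * (p.derivative.eval v * ((v - u) / 2)) ≤ (n : ℝ) ^ 2 := by
    intro c hc
    have hq := Chebyshev.eval_iterate_derivative_le_of_forall_abs_le_one (n := n) (k := 1)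
      (P := C c * p.comp (C ((u + v) / 2) + C ((v - u) / 2) * X)) (le_refl (1 : ℝ))
      (natDegree_le_iff_degree_le.1 <| by
        refine (natDegree_C_mul_le _ _).trans (natDegree_comp_le.trans ?_)
        have h1 : (C ((u + v) / 2) + C ((v - u) / 2) * X : ℝ[X]).natDegree ≤ 1 := by
          compute_degree
        nlinarith)
      (by
        rintro t ⟨ht1, ht2⟩
        simp only [eval_mul, eval_C, eval_comp, eval_add, eval_X, abs_mul, hc]
        rw [inv_mul_le_iff₀ hB, mul_one]
        apply h
        rcases le_total u v with huv | huv
        · rw [Set.uIcc_of_le huv]; constructor <;> nlinarith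
        · rw [Set.uIcc_of_ge huv]; constructor <;> nlinarith)
    have hT := Chebyshev.iterate_derivative_T_eval_one (R := ℝ) (n : ℤ) 1
    simp only [Function.iterate_one] at hq hT
    have hv : (u + v) / 2 + (v - u) / 2 = v := by ring
    simp [derivative_comp, hv] at hq hT
    rw [hT] at hq
    linarith
  have hB' : |B⁻¹| = B⁻¹ := abs_of_pos (by positivity)
  have h1 := key B⁻¹ hB'
  have h2 := key (-B⁻¹) (by rw [abs_neg, hB'])
  rw [← abs_mul]
  have h3 : B⁻¹ * |p.derivative.eval v * (v - u)| ≤ 2 * (n : ℝ) ^ 2 := by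
    rw [← hB', ← abs_mul, abs_le]
    constructor <;> nlinarith
  rw [inv_mul_le_iff₀ hB] at h3
  linarith

/-- Markov's inequality on an interval, with a non-optimal constant. -/
theorem abs_eval_derivative_le_of_forall_abs_le {p : ℝ[X]} {n : ℕ} {a b B t : ℝ}
    (hp : p.natDegree ≤ n) (hab : a < b) (h : ∀ t ∈ Set.Icc a b, |p.eval t| ≤ B)
    (ht : t ∈ Set.Icc a b) :
    |p.derivative.eval t| ≤ 4 / (b - a) * (n : ℝ) ^ 2 * B := by
  have hB : 0 ≤ B := (abs_nonneg _).trans (h t ht)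
  have hpos : 0 < b - a := sub_pos.2 hab
  -- The endpoint estimate needs a positive bound, so `B` is approached from above.
  suffices H : ∀ B' : ℝ, B < B' → |p.derivative.eval t| ≤ 4 / (b - a) * (n : ℝ) ^ 2 * B' by
    have hc : Filter.Tendsto (fun B' : ℝ => 4 / (b - a) * (n : ℝ) ^ 2 * B')
        (nhdsWithin B (Set.Ioi B)) (nhds (4 / (b - a) * (n : ℝ) ^ 2 * B)) :=
      ((continuous_const.mul continuous_id).tendsto B).mono_left nhdsWithin_le_nhds
    exact ge_of_tendsto hc (by filter_upwards [self_mem_nhdsWithin] with B' hB' using H B' hB')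
  intro B' hB'
  -- Some end `u` of the interval lies at distance at least `(b - a) / 2` from `t`; `t` is then an
  -- endpoint of the segment from `u`.
  have key : ∀ u ∈ Set.Icc a b, (b - a) / 2 ≤ |t - u| →
      |p.derivative.eval t| ≤ 4 / (b - a) * (n : ℝ) ^ 2 * B' := by
    intro u hu htu
    have h1 := abs_eval_derivative_mul_le (u := u) (v := t) hp (hB.trans_lt hB')
      fun s hs => (h s (Set.uIcc_subset_Icc hu ht hs)).trans hB'.le
    have h2 : |p.derivative.eval t| * ((b - a) / 2) ≤ 2 * (n : ℝ) ^ 2 * B' :=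
      (mul_le_mul_of_nonneg_left htu (abs_nonneg _)).trans h1
    rw [div_mul_eq_mul_div, div_mul_eq_mul_div, le_div_iff₀ hpos]
    linarith
  rcases le_total ((a + b) / 2) t with hm | hm
  · exact key a ⟨le_rfl, hab.le⟩ (le_trans (by linarith) (le_abs_self _))
  · exact key b ⟨hab.le, le_rfl⟩ (le_trans (by linarith) (neg_le_abs _))

end Polynomial

/-! ### Sup norms and reduction to first-order derivatives -/

namespace MarkovInequality

open MvPolynomial

theorem supNorm_nonneg {N : ℕ} (E : Set (Fin N → ℝ)) (P : MvPolynomial (Fin N) ℝ) :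
    0 ≤ supNorm E P :=
  Real.iSup_nonneg fun _ => abs_nonneg _

theorem supNorm_le {N : ℕ} {E : Set (Fin N → ℝ)} {P : MvPolynomial (Fin N) ℝ} {B : ℝ}
    (hB : 0 ≤ B) (h : ∀ p ∈ E, |eval p P| ≤ B) : supNorm E P ≤ B :=
  Real.iSup_le (fun p => h p p.2) hB

theorem abs_eval_le_supNorm {N : ℕ} {E : Set (Fin N → ℝ)} (hE : IsCompact E)
    (P : MvPolynomial (Fin N) ℝ) {p : Fin N → ℝ} (hp : p ∈ E) : |eval p P| ≤ supNorm E P := by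
  have hbdd : BddAbove ((fun p : Fin N → ℝ => |eval p P|) '' E) :=
    hE.bddAbove_image (MvPolynomial.continuous_eval P).abs.continuousOn
  refine le_ciSup (f := fun x : E => |eval (x : Fin N → ℝ) P|) ?_ ⟨p, hp⟩
  rwa [Set.image_eq_range] at hbdd

theorem supNorm_zero {N : ℕ} (E : Set (Fin N → ℝ)) :
    supNorm E (0 : MvPolynomial (Fin N) ℝ) = 0 :=
  le_antisymm (supNorm_le le_rfl (by simp)) (supNorm_nonneg _ _)

/-- Markov bounds on first-order partial derivatives give the bounds on all derivatives. -/
theorem isMarkovSet_of_supNorm_pderiv_le {N : ℕ} (F : PolySpace N) {E : Set (Fin N → ℝ)}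
    (hE : IsCompact E) (hF : ∀ P ∈ F.toSubmodule, ∀ i, pderiv i P ∈ F.toSubmodule)
    {M : ℝ} {m : ℕ} (hM : 0 < M) (hm : 0 < m)
    (h : ∀ P ∈ F.toSubmodule, ∀ i, supNorm E (pderiv i P) ≤
      M * (P.totalDegree : ℝ) ^ m * supNorm E P) :
    IsMarkovSet F E := by
  refine ⟨hE, M, m, hM, by exact_mod_cast hm, fun P hP α => ?_⟩
  set d := P.totalDegree with hd
  set K : ℝ := M * (d : ℝ) ^ m with hK
  have hK0 : 0 ≤ K := by positivity
  -- Differentiation does not raise the degree, so one factor `K` serves every derivative taken.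
  have step : ∀ (i : Fin N) (n : ℕ) (Q : MvPolynomial (Fin N) ℝ), Q ∈ F.toSubmodule →
      Q.totalDegree ≤ d →
      (((pderiv i).toLinearMap : Module.End ℝ (MvPolynomial (Fin N) ℝ)) ^ n) Q ∈ F.toSubmodule ∧
      ((((pderiv i).toLinearMap : Module.End ℝ (MvPolynomial (Fin N) ℝ)) ^ n) Q).totalDegree ≤ d ∧
      supNorm E ((((pderiv i).toLinearMap : Module.End ℝ (MvPolynomial (Fin N) ℝ)) ^ n) Q) ≤
        K ^ n * supNorm E Q := by
    intro i n Q hQ hQd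
    induction n with
    | zero => simpa using ⟨hQ, hQd⟩
    | succ n ih =>
      obtain ⟨h1, h2, h3⟩ := ih
      rw [pow_succ', Module.End.mul_apply]
      refine ⟨hF _ h1 i, (totalDegree_pderiv_le i _).trans h2, (h _ h1 i).trans ?_⟩
      rw [pow_succ', mul_assoc K]
      refine mul_le_mul ?_ h3 (supNorm_nonneg _ _) hK0
      rw [hK]
      gcongr
  have key : ∀ l : List (Fin N),
      (l.map fun i => ((pderiv i).toLinearMap : Module.End ℝ (MvPolynomial (Fin N) ℝ)) ^ α i).prod P
        ∈ F.toSubmodule ∧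
      ((l.map fun i => ((pderiv i).toLinearMap :
        Module.End ℝ (MvPolynomial (Fin N) ℝ)) ^ α i).prod P).totalDegree ≤ d ∧
      supNorm E ((l.map fun i => ((pderiv i).toLinearMap :
        Module.End ℝ (MvPolynomial (Fin N) ℝ)) ^ α i).prod P) ≤
        K ^ (l.map α).sum * supNorm E P := by
    intro l
    induction l with
    | nil => simpa using ⟨hP, hd.ge⟩
    | cons i l ih =>
      obtain ⟨h1, h2, h3⟩ := ih
      obtain ⟨s1, s2, s3⟩ := step i (α i) _ h1 h2
      simp only [List.map_cons, List.prod_cons, List.sum_cons, Module.End.mul_apply]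
      refine ⟨s1, s2, s3.trans ?_⟩
      rw [pow_add, mul_assoc]
      gcongr
  have := (key (List.finRange N)).2.2
  rw [← List.ofFn_eq_map, ← List.ofFn_eq_map, List.sum_ofFn] at this
  refine this.trans_eq ?_
  rw [hK, mul_pow, ← pow_mul, multiLength]
  congr 2
  rw [← Real.rpow_natCast]
  push_cast
  rfl

/-! ### Geometry of `E` -/

theorem isCompact_setE : IsCompact setE := by
  have hcl : IsClosed setE := by
    refine IsClosed.inter (isClosed_eq (by fun_prop) (by fun_prop)) ?_
    exact (isClosed_Icc.union isClosed_Icc).preimage (continuous_apply 0)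
  refine (isCompact_Icc (a := fun _ : Fin 2 => (-1 : ℝ)) (b := fun _ => 1)).of_isClosed_subset hcl ?_
  rintro p ⟨hp, hx⟩
  have hp : p 1 ^ 3 = 1 - p 0 ^ 2 := hp
  have hx2 : -1 / 2 ≤ p 0 ∧ p 0 ≤ 1 / 2 := by
    rcases hx with ⟨h1, h2⟩ | ⟨h1, h2⟩ <;> constructor <;> linarith
  have hmono := (show Odd 3 by decide).strictMono_pow (R := ℝ)
  have h1 : p 1 ≤ 1 := hmono.le_iff_le.1 (by nlinarith)
  have h2 : -1 ≤ p 1 := hmono.le_iff_le.1 (by nlinarith)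
  constructor <;> intro i <;> fin_cases i <;> simp <;> linarith

theorem mem_setE_iff {x y : ℝ} :
    ![x, y] ∈ setE ↔ y ^ 3 = 1 - x ^ 2 ∧ 1 / 16 ≤ x ^ 2 ∧ x ^ 2 ≤ 1 / 4 := by
  simp only [setE, curveV, Set.mem_ofPred_eq, Set.mem_union, Set.mem_Icc, Matrix.cons_val_zero,
    Matrix.cons_val_one]
  refine and_congr_right fun _ => ⟨?_, fun ⟨h1, h2⟩ => ?_⟩
  · rintro (⟨h1, h2⟩ | ⟨h1, h2⟩) <;> constructor <;> nlinarith
  · have h3 : |x| ≤ 1 / 2 := abs_le.2 ⟨by nlinarith, by nlinarith⟩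
    have h4 : 1 / 4 ≤ |x| := by
      rw [← abs_of_pos (show (0 : ℝ) < 1 / 4 by norm_num), ← sq_le_sq]; linarith
    rcases le_total 0 x with h | h
    · rw [abs_of_nonneg h] at h3 h4; exact Or.inr ⟨h4, h3⟩
    · rw [abs_of_nonpos h] at h3 h4; left; constructor <;> linarith

theorem eq_vec_apply {p : Fin 2 → ℝ} : p = ![p 0, p 1] := by
  ext i; fin_cases i <;> rfl

/-- The vertical projection of `E` is a nondegenerate interval each of whose points has two
opposite abscissas in `E`. -/
theorem exists_interval_setE : ∃ a b : ℝ, 1 / 16 ≤ b - a ∧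
    (∀ x y : ℝ, ![x, y] ∈ setE → y ∈ Set.Icc a b) ∧
    ∀ y ∈ Set.Icc a b, ∃ x : ℝ, 1 / 4 ≤ x ∧ ![x, y] ∈ setE ∧ ![-x, y] ∈ setE := by
  have hroot : ∀ c : ℝ, 0 ≤ c → ∃ a : ℝ, 0 ≤ a ∧ a ^ 3 = c := fun c hc =>
    ⟨c ^ ((3 : ℕ) : ℝ)⁻¹, by positivity, Real.rpow_inv_natCast_pow hc (by norm_num)⟩
  obtain ⟨a, ha0, ha⟩ := hroot (3 / 4) (by norm_num)
  obtain ⟨b, hb0, hb⟩ := hroot (15 / 16) (by norm_num)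
  have hmono := (show Odd 3 by decide).strictMono_pow (R := ℝ)
  have ha1 : a ≤ 1 := hmono.le_iff_le.1 (by linarith)
  have hb1 : b ≤ 1 := hmono.le_iff_le.1 (by linarith)
  have hab : a ≤ b := hmono.le_iff_le.1 (by linarith)
  refine ⟨a, b, ?_, ?_, ?_⟩
  · have h1 : (b - a) * (b ^ 2 + a * b + a ^ 2) = 3 / 16 := by linear_combination hb - ha
    have h2 : b ^ 2 + a * b + a ^ 2 ≤ 3 := by nlinarith
    nlinarith
  · intro x y hxy
    obtain ⟨h, h1, h2⟩ := mem_setE_iff.1 hxy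
    exact ⟨hmono.le_iff_le.1 (by linarith), hmono.le_iff_le.1 (by linarith)⟩
  · rintro y ⟨h1, h2⟩
    have h1' : a ^ 3 ≤ y ^ 3 := hmono.monotone h1
    have h2' : y ^ 3 ≤ b ^ 3 := hmono.monotone h2
    have hs : √(1 - y ^ 3) ^ 2 = 1 - y ^ 3 := Real.sq_sqrt (by linarith)
    refine ⟨√(1 - y ^ 3), Real.le_sqrt_of_sq_le (by linarith), mem_setE_iff.2 ?_,
      mem_setE_iff.2 ?_⟩ <;>
    · simp only [neg_sq, hs]
      refine ⟨by ring, by linarith, by linarith⟩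

/-! ### The Markov property for `𝒫(y) ⊗ 𝒫₁(x)` -/

theorem eval_eq_of_mem_supported {N : ℕ} {k : Fin N} {G : MvPolynomial (Fin N) ℝ}
    (hG : G ∈ supported ℝ ({k}ᶜ : Set (Fin N))) {p q : Fin N → ℝ} (h : ∀ i ≠ k, p i = q i) :
    eval p G = eval q G := by
  refine MvPolynomial.eval₂Hom_congr' rfl (fun i hi _ => h i ?_) rfl
  exact mem_supported.1 hG hi

theorem eval_aeval_vec (x t : ℝ) (P : MvPolynomial (Fin 2) ℝ) :
    (aeval ![Polynomial.C x, Polynomial.X] P).eval t = eval ![x, t] P := by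
  induction P using MvPolynomial.induction_on with
  | C c => simp
  | add P Q hP hQ => simp [hP, hQ]
  | mul_X P i hP => fin_cases i <;> simp [hP]

/-- On a vertical line `∂_y` is an ordinary derivative; this is how the one-variable inequality
enters. -/
theorem eval_derivative_aeval_vec (x t : ℝ) (P : MvPolynomial (Fin 2) ℝ) :
    (aeval ![Polynomial.C x, Polynomial.X] P).derivative.eval t = eval ![x, t] (pderiv 1 P) := by
  induction P using MvPolynomial.induction_on with
  | C c => simp
  | add P Q hP hQ => simp [hP, hQ]
  | mul_X P i hP =>
    have hP' := eval_aeval_vec x t P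
    fin_cases i <;> simp [hP, hP', pderiv_X] <;> ring

theorem isMarkovSet_tensorSpace_zero_one : IsMarkovSet (tensorSpace (0 : Fin 2) 1) setE := by
  obtain ⟨a, b, hab, hproj, hlift⟩ := exists_interval_setE
  have hab' : a < b := by linarith
  -- `192 = 64 · 3`: `64` bounds `4 / (b - a)`, and `3S` bounds `P` on the vertical segments used.
  refine isMarkovSet_of_supNorm_pderiv_le (M := 192) (m := 2) _ isCompact_setE
    (fun P hP i => pderiv_mem_tensorSubmodule 0 i 1 hP) (by norm_num) (by norm_num) ?_
  intro P hP i
  obtain ⟨G, hG, hPG⟩ := hP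
  have hPG : P = G 0 + G 1 * X 0 := by rw [hPG]; simp [Finset.sum_range_succ]
  set S := supNorm setE P with hS
  have hS0 : 0 ≤ S := supNorm_nonneg _ _
  have hGe : ∀ j (x x' y : ℝ), eval ![x, y] (G j) = eval ![x', y] (G j) := fun j x x' y =>
    eval_eq_of_mem_supported (hG j) (by intro i hi; fin_cases i <;> simp_all)
  have hPe : ∀ x y : ℝ, eval ![x, y] P = eval ![0, y] (G 0) + eval ![0, y] (G 1) * x := by
    intro x y
    rw [hPG, hGe 0 0 x, hGe 1 0 x]; simp
  -- `G₀` and `x G₁` are the half-sum and half-difference of the values at `(±x, y)`.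
  have hbound : ∀ y ∈ Set.Icc a b, |eval ![0, y] (G 0)| ≤ S ∧ |eval ![0, y] (G 1)| ≤ 4 * S := by
    intro y hy
    obtain ⟨x, hx, h1, h2⟩ := hlift y hy
    have e1 := abs_le.1 (abs_eval_le_supNorm isCompact_setE P h1)
    have e2 := abs_le.1 (abs_eval_le_supNorm isCompact_setE P h2)
    rw [hPe, ← hS] at e1 e2
    have e3 : |eval ![0, y] (G 1)| * x ≤ S := by
      rw [← abs_of_nonneg (show 0 ≤ x by linarith), ← abs_mul]
      exact abs_le.2 ⟨by linarith, by linarith⟩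
    refine ⟨abs_le.2 ⟨by linarith, by linarith⟩, ?_⟩
    nlinarith [abs_nonneg (eval ![0, y] (G 1))]
  rcases Nat.eq_zero_or_pos P.totalDegree with hd | hd
  · rw [totalDegree_eq_zero_iff_eq_C.1 hd, pderiv_C, supNorm_zero]
    positivity
  have hd1 : (1 : ℝ) ≤ (P.totalDegree : ℝ) ^ 2 :=
    one_le_pow₀ (by exact_mod_cast hd)
  refine supNorm_le (by positivity) fun p hp => ?_
  rw [eq_vec_apply (p := p)] at hp ⊢
  generalize p 0 = x at hp ⊢
  generalize p 1 = y at hp ⊢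
  have hy := hproj x y hp
  have hx : |x| ≤ 1 / 2 := by
    have := (mem_setE_iff.1 hp).2.2
    exact abs_le.2 ⟨by nlinarith, by nlinarith⟩
  fin_cases i
  · have : pderiv 0 P = G 1 := by
      rw [hPG]
      simp [pderiv_eq_zero_of_mem_supported 0 (hG _)]
    simp only [Fin.zero_eta, this]
    rw [hGe 1 x 0]
    refine (hbound y hy).2.trans ?_
    nlinarith
  · simp only [Fin.mk_one]
    rw [← eval_derivative_aeval_vec]
    have h1 : (aeval ![Polynomial.C x, Polynomial.X] P : Polynomial ℝ).natDegree ≤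
        P.totalDegree := by
      have := MvPolynomial.aeval_natDegree_le P le_rfl
        (![Polynomial.C x, Polynomial.X] : Fin 2 → Polynomial ℝ) (n := 1)
        (by intro i; fin_cases i <;> simp)
      simpa using this
    -- The segment `{x} × [a, b]` leaves `E`, but the coefficient bounds still give `S + 4S · 1/2 =
    -- 3S`.
    have h2 := Polynomial.abs_eval_derivative_le_of_forall_abs_le (B := 3 * S) h1 hab' (by
      intro t ht
      obtain ⟨b0, b1⟩ := hbound t ht
      rw [eval_aeval_vec, hPe]
      refine (abs_add_le _ _).trans ?_
      rw [abs_mul]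
      nlinarith [abs_nonneg (eval ![0, t] (G 1)), abs_nonneg x]) hy
    refine h2.trans ?_
    have h3 : 4 / (b - a) ≤ 64 := by
      rw [div_le_iff₀ (by linarith)]; linarith
    calc _ ≤ 64 * (P.totalDegree : ℝ) ^ 2 * (3 * S) := by gcongr
      _ = _ := by ring

/-! ### Failure for `𝒫(x) ⊗ 𝒫₂(y)` -/

/-- The `i`-th coefficient, with respect to `y`, of the reduction of `(y - 1) ^ n` modulo the
equation `y³ = 1 - x²`. -/
noncomputable def reducedCoeff : ℕ → ℕ → MvPolynomial (Fin 2) ℝ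
  | 0, 0 => 1
  | 0, _ + 1 => 0
  | n + 1, 0 => (1 - X 0 ^ 2) * reducedCoeff n 2 - reducedCoeff n 0
  -- Only indices at most `2` are meaningful; larger ones never feed back into them.
  | n + 1, i + 1 => reducedCoeff n i - reducedCoeff n (i + 1)

/-- The reduction of `(y - 1) ^ n` modulo the equation `y³ = 1 - x²`. -/
noncomputable def reducedPow (n : ℕ) : MvPolynomial (Fin 2) ℝ :=
  ∑ i ∈ Finset.range 3, reducedCoeff n i * X 1 ^ i

theorem reducedCoeff_mem_supported (n i : ℕ) :
    reducedCoeff n i ∈ supported ℝ ({1}ᶜ : Set (Fin 2)) := by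
  induction n generalizing i with
  | zero =>
    cases i
    · exact Subalgebra.one_mem _
    · exact Subalgebra.zero_mem _
  | succ n ih =>
    cases i
    · exact Subalgebra.sub_mem _ (Subalgebra.mul_mem _ (Subalgebra.sub_mem _
        (Subalgebra.one_mem _) (Subalgebra.pow_mem _ (X_mem_supported.2 (by simp)) _)) (ih _)) (ih _)
    · exact Subalgebra.sub_mem _ (ih _) (ih _)

theorem totalDegree_reducedCoeff_le (n i : ℕ) : (reducedCoeff n i).totalDegree ≤ 2 * n := by
  induction n generalizing i with
  | zero => cases i <;> simp [reducedCoeff]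
  | succ n ih =>
    cases i
    · refine (totalDegree_sub _ _).trans (max_le ((totalDegree_mul _ _).trans ?_)
        ((ih _).trans (by omega)))
      have : (1 - X 0 ^ 2 : MvPolynomial (Fin 2) ℝ).totalDegree ≤ 2 :=
        (totalDegree_sub _ _).trans (by simp [totalDegree_X_pow])
      have := ih 2
      omega
    · exact (totalDegree_sub _ _).trans (max_le ((ih _).trans (by omega)) ((ih _).trans (by omega)))

theorem totalDegree_reducedPow_le (n : ℕ) : (reducedPow n).totalDegree ≤ 2 * (n + 1) := by
  refine totalDegree_finsetSum_le fun i hi => (totalDegree_mul _ _).trans ?_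
  have := totalDegree_reducedCoeff_le n i
  have := Finset.mem_range.1 hi
  rw [totalDegree_X_pow]
  omega

theorem reducedPow_eq (n : ℕ) : reducedPow n =
    reducedCoeff n 0 + reducedCoeff n 1 * X 1 + reducedCoeff n 2 * X 1 ^ 2 := by
  simp [reducedPow, Finset.sum_range_succ]

theorem eval_reducedPow {p : Fin 2 → ℝ} (hp : p ∈ curveV) (n : ℕ) :
    eval p (reducedPow n) = (p 1 - 1) ^ n := by
  have hp : p 1 ^ 3 = 1 - p 0 ^ 2 := hp
  induction n with
  | zero => simp [reducedPow_eq, reducedCoeff]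
  | succ n ih =>
    rw [pow_succ, ← ih, reducedPow_eq, reducedPow_eq]
    simp only [reducedCoeff, map_add, map_sub, map_mul, map_pow, map_one, eval_X]
    linear_combination -(eval p (reducedCoeff n 2)) * hp

/-- The product of the values of `(y - 1) ^ n` at the two conjugates of `y` over the field of
rational functions in `x`. -/
theorem eval_reducedCoeff_quadratic {p : Fin 2 → ℝ} (hp : p ∈ curveV) {n : ℕ} {A₀ A₁ A₂ : ℝ}
    (h₀ : A₀ = eval p (reducedCoeff n 0)) (h₁ : A₁ = eval p (reducedCoeff n 1) * p 1)
    (h₂ : A₂ = eval p (reducedCoeff n 2) * p 1 ^ 2) :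
    A₀ ^ 2 + A₁ ^ 2 + A₂ ^ 2 - A₀ * A₁ - A₁ * A₂ - A₀ * A₂ = (p 1 ^ 2 + p 1 + 1) ^ n := by
  have hp : 1 - p 0 ^ 2 = p 1 ^ 3 := Eq.symm hp
  subst h₀ h₁ h₂
  induction n with
  | zero => simp [reducedCoeff]
  | succ n ih =>
    -- The form is `|A₀ + A₁ω + A₂ω²|²` for a primitive cube root of unity `ω`; each step multiplies
    -- it by `|ωy - 1|² = y² + y + 1`.
    rw [pow_succ (p 1 ^ 2 + p 1 + 1), ← ih]
    simp only [reducedCoeff, map_sub, map_mul, map_pow, map_one, eval_X, hp]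
    ring

theorem iterDeriv_vec_zero (n : ℕ) (P : MvPolynomial (Fin 2) ℝ) :
    iterDeriv ![0, n] P = (pderiv 1)^[n] P := by
  simp [iterDeriv, Module.End.pow_apply]

theorem pderiv_reducedPow (n : ℕ) : pderiv 1 (reducedPow n) =
    reducedCoeff n 1 + 2 * reducedCoeff n 2 * X 1 := by
  have h := fun i => pderiv_eq_zero_of_mem_supported 1 (reducedCoeff_mem_supported n i)
  rw [reducedPow_eq]
  simp [h, Derivation.leibniz_pow]
  ring

theorem pderiv_pderiv_reducedPow (n : ℕ) : pderiv 1 (pderiv 1 (reducedPow n)) =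
    2 * reducedCoeff n 2 := by
  have h := fun i => pderiv_eq_zero_of_mem_supported 1 (reducedCoeff_mem_supported n i)
  rw [pderiv_reducedPow, show (2 : MvPolynomial (Fin 2) ℝ) = C 2 from (map_ofNat C 2).symm]
  simp [h]

theorem not_isMarkovSet_tensorSpace_one_two :
    ¬ IsMarkovSet (tensorSpace (1 : Fin 2) 2) setE := by
  rintro ⟨hE, M, m, hM, hm, h⟩
  -- Only derivatives of order at most `2` occur, so the degree exponent never exceeds `2m`.
  obtain ⟨k, hk⟩ := exists_nat_ge (2 * m)
  have hlim : Filter.Tendsto (fun n : ℕ =>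
      (1 + M + M ^ 2) * 2 ^ (k + 1) * (((n + 1 : ℕ) : ℝ) ^ k * (1 / 2) ^ (n + 1)))
      Filter.atTop (nhds 0) := by
    have := (tendsto_pow_const_mul_const_pow_of_abs_lt_one k (r := (1 / 2 : ℝ))
      (by norm_num [abs_of_pos])).comp (Filter.tendsto_add_atTop_nat 1)
    simpa using this.const_mul ((1 + M + M ^ 2) * 2 ^ (k + 1))
  obtain ⟨n, hn⟩ := (hlim.eventually_lt_const (show (0 : ℝ) < 1 / 10 by norm_num)).exists
  set T : ℝ := ((2 * (n + 1) : ℕ) : ℝ) with hT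
  have hT1 : 1 ≤ T := by rw [hT]; exact_mod_cast (by omega)
  set L : ℝ := (1 + M + M ^ 2) * T ^ k * (1 / 2) ^ n with hL
  have hL10 : L < 1 / 10 := by
    refine lt_of_eq_of_lt ?_ hn
    rw [hL, hT]; push_cast; rw [mul_pow]; ring
  have hmem : reducedPow n ∈ (tensorSpace (1 : Fin 2) 2).toSubmodule :=
    ⟨reducedCoeff n, reducedCoeff_mem_supported n, rfl⟩
  have hy : ∀ p ∈ setE, 1 / 2 ≤ p 1 ∧ p 1 ≤ 1 := by
    intro p hp
    rw [eq_vec_apply (p := p)] at hp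
    obtain ⟨h1, h2, h3⟩ := mem_setE_iff.1 hp
    have hmono := (show Odd 3 by decide).strictMono_pow (R := ℝ)
    exact ⟨hmono.le_iff_le.1 (by linarith), hmono.le_iff_le.1 (by linarith)⟩
  have hS : supNorm setE (reducedPow n) ≤ (1 / 2) ^ n := by
    refine supNorm_le (by positivity) fun p hp => ?_
    rw [eval_reducedPow hp.1, abs_pow]
    have := hy p hp
    exact pow_le_pow_left₀ (abs_nonneg _) (abs_le.2 ⟨by linarith, by linarith⟩) _
  have hder : ∀ j : ℕ, j ≤ 2 →
      supNorm setE ((pderiv 1)^[j] (reducedPow n)) ≤ M ^ j * T ^ k * (1 / 2) ^ n := by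
    intro j hj
    have h1 := h _ hmem ![0, j]
    rw [iterDeriv_vec_zero, show multiLength ![0, j] = j by simp [multiLength]] at h1
    refine h1.trans ?_
    have hj' : (j : ℝ) ≤ 2 := by exact_mod_cast hj
    have h2 : ((reducedPow n).totalDegree : ℝ) ^ (m * (j : ℝ)) ≤ T ^ k := calc
      _ ≤ T ^ (m * (j : ℝ)) := by
        refine Real.rpow_le_rpow (by positivity) ?_ (by positivity)
        rw [hT]; exact_mod_cast totalDegree_reducedPow_le n
      _ ≤ T ^ (k : ℝ) := Real.rpow_le_rpow_of_exponent_le hT1 (by nlinarith)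
      _ = T ^ k := Real.rpow_natCast _ _
    have := supNorm_nonneg setE (reducedPow n)
    gcongr
  obtain ⟨p, hp⟩ : setE.Nonempty := by
    obtain ⟨a, b, hab, -, hlift⟩ := exists_interval_setE
    obtain ⟨x, -, hx, -⟩ := hlift a ⟨le_rfl, by linarith⟩
    exact ⟨_, hx⟩
  obtain ⟨hy1, hy2⟩ := hy p hp
  have hR : 0 ≤ T ^ k * (1 / 2) ^ n := by positivity
  have hLe : L = T ^ k * (1 / 2) ^ n + M * (T ^ k * (1 / 2) ^ n) + M ^ 2 * (T ^ k * (1 / 2) ^ n) := by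
    rw [hL]; ring
  have hMR : 0 ≤ M * (T ^ k * (1 / 2) ^ n) := by positivity
  have hMR2 : 0 ≤ M ^ 2 * (T ^ k * (1 / 2) ^ n) := by positivity
  have b0 := (abs_eval_le_supNorm hE _ hp).trans (hder 0 (by norm_num))
  have b1 := (abs_eval_le_supNorm hE _ hp).trans (hder 1 (by norm_num))
  have b2 := (abs_eval_le_supNorm hE _ hp).trans (hder 2 (by norm_num))
  simp only [Function.iterate_succ, Function.iterate_zero, Function.comp_apply, id_eq,
    pderiv_pderiv_reducedPow] at b0 b1 b2
  rw [pderiv_reducedPow] at b1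
  rw [reducedPow_eq] at b0
  have hQ := eval_reducedCoeff_quadratic hp.1 (n := n) rfl rfl rfl
  have hQ1 : 1 ≤ (p 1 ^ 2 + p 1 + 1) ^ n := one_le_pow₀ (by nlinarith)
  rw [← hQ] at hQ1
  simp only [map_add, map_mul, map_pow, eval_X, map_ofNat] at b0 b1 b2
  generalize eval p (reducedCoeff n 0) = g₀ at *
  generalize eval p (reducedCoeff n 1) = g₁ at *
  generalize eval p (reducedCoeff n 2) = g₂ at *
  generalize p 1 = y at *
  -- The value, `y∂_y` and `½y²∂_y²` form a triangular system in `g₀`, `g₁ y`, `g₂ y²`.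
  have c0 : |g₀ + g₁ * y + g₂ * y ^ 2| ≤ L := b0.trans (by linarith)
  have c1 : |g₁ * y + 2 * (g₂ * y ^ 2)| ≤ L := by
    rw [show g₁ * y + 2 * (g₂ * y ^ 2) = (g₁ + 2 * g₂ * y) * y by ring, abs_mul,
      abs_of_pos (by linarith : 0 < y)]
    refine (mul_le_of_le_one_right (abs_nonneg _) hy2).trans (b1.trans (by linarith))
  have c2 : |g₂ * y ^ 2| ≤ L := by
    rw [abs_mul, abs_of_nonneg (sq_nonneg y)]
    refine (mul_le_of_le_one_right (abs_nonneg _) (pow_le_one₀ (by linarith) hy2)).trans ?_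
    rw [abs_mul, abs_of_pos (by norm_num : (0 : ℝ) < 2)] at b2
    have := abs_nonneg g₂
    linarith
  generalize g₁ * y = A₁ at *
  generalize g₂ * y ^ 2 = A₂ at *
  rw [abs_le] at c0 c1 c2
  -- With these bounds the six terms of the form total at most `0.58 < 1`.
  have d0 : |g₀| ≤ 1 / 2 := abs_le.2 ⟨by linarith, by linarith⟩
  have d1 : |A₁| ≤ 3 / 10 := abs_le.2 ⟨by linarith, by linarith⟩
  have d2 : |A₂| ≤ 1 / 10 := abs_le.2 ⟨by linarith, by linarith⟩
  have q : ∀ {s t c d : ℝ}, |s| ≤ c → |t| ≤ d → |s * t| ≤ c * d := fun hs ht => by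
    rw [abs_mul]; exact mul_le_mul hs ht (abs_nonneg _) ((abs_nonneg _).trans hs)
  have := abs_le.1 (q d0 d0)
  have := abs_le.1 (q d1 d1)
  have := abs_le.1 (q d2 d2)
  have := abs_le.1 (q d0 d1)
  have := abs_le.1 (q d1 d2)
  have := abs_le.1 (q d0 d2)
  nlinarith

end MarkovInequality

theorem mainTheorem4 :
    MarkovInequality.IsMarkovSet (MarkovInequality.tensorSpace (0 : Fin 2) 1)
        MarkovInequality.setE ∧
      ¬ MarkovInequality.IsMarkovSet (MarkovInequality.tensorSpace (1 : Fin 2) 2)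
        MarkovInequality.setE :=
  ⟨MarkovInequality.isMarkovSet_tensorSpace_zero_one,
    MarkovInequality.not_isMarkovSet_tensorSpace_one_two⟩
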